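/- Fix a dyadic lattice $\mathcal D=\{[x_0+m2^k\ell,\;x_0+(m+1)2^k\ell): k,m\in\mathbb Z\}$ on $\mathbb R$ ($x_0\in\mathbb R$, $\ell>0$). For $I\in\mathcal D$ let $\mathcal D(I)=\{J\in\mathcal D: J\subseteq I\}$, and let $J^-,J^+$ be the left and right halves of $J\in\mathcal D$. A weight is a locally integrable function $w$ on $\mathbb R$ with $w>0$ a.e. Write $\langle w\rangle_J=\frac1{|J|}\int_J w$, $\Delta_Jw=\langle w\rangle_{J^-}-\langle w\rangle_{J^+}$, and $$[w]=\sup_{J\in\mathcal D}\langle w\rangle_J\langle w^{-1}\rangle_J\in[1,\infty];$$ $w\in A_2^d$ means that $w$ is a weight with $[w]<\infty$. A sequence $c=\{c_J\}_{J\in\mathcal D}$ of non-negative numbers is Carleson if $\|c\|_{\mathcal C}:=\sup_{I\in\mathcal D}\frac1{|I|}\sum_{J\in\mathcal D(I)}c_J<\infty$. Let $\Phi:[1,\infty)\to[0,\infty)$ be increasing (not necessarily strictly). For a weight $w$ such that $w^{-1}$ is also a weight, define the sequence $c^\Phi(w)$ by $$c_J^\Phi(w)=|J|\,\Phi\big(\langle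 w\rangle_J\langle w^{-1}\rangle_J\big)\left[\frac{(\Delta_Jw)^2}{\langle w\rangle_J^2}+\frac{(\Delta_Jw^{-1})^2}{\langle w^{-1}\rangle_J^2}\right],\qquad J\in\mathcal D.$$ **Theorem 2.6.** (i) If $w\in A_2^d$, then $c^\Phi(w)$ is Carleson and $\|c^\Phi(w)\|_{\mathcal C}\le 8\,\Phi([w])\log[w]$. (ii) Suppose that $\lim_{t\to\infty}\Phi(t)=\infty$. Put $u(Q)=\frac8Q\int_1^Q\Phi(t)\,dt$ for $Q\ge1$, and $v(y)=\sup\{Q\ge1: u(Q)\le y\}$ for $y\ge0$. Then $v$ maps $[0,\infty)$ into $[1,\infty)$ and $u(v(y))=y$ for all $y\ge0$; if moreover $\Phi>0$ on $(1,\infty)$, then $u$ is a bijection of $[1,\infty)$ onto $[0,\infty)$ and $v$ is its inverse. If $w$ and $w^{-1}$ are weights and $c^\Phi(w)$ is Carleson, then $w\in A_2^d$ and $$[w]\le v\big(\|c^\Phi(w)\|_{\mathcal C}\big).$$ (iii) If it is not the case that $\lim_{t\to\infty}\Phi(t)=\infty$ (that is, if $\Phi$ is bounded), then there is a weight $w$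 such that $w^{-1}$ is also a weight, $w\notin A_2^d$, and $c^\Phi(w)$ is Carleson. -/

import Mathlib

open MeasureTheory Set Filter
open scoped ENNReal

namespace DyadicA2

/-- A dyadic lattice on the line, given by the position and the size of its root interval. -/
structure Lattice where
  origin : ℝ
  size : ℝ
  size_pos : 0 < size

/-- Index set of the dyadic intervals: `(k, m)` stands for the `m`-th interval of length
`2 ^ k * size`. -/
abbrev Index : Type := ℤ × ℤ

namespace Lattice

/-- The length `|J|`. -/
noncomputable def length (D : Lattice) (J : Index) : ℝ := D.size * (2 : ℝ) ^ J.1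

/-- The dyadic interval `[origin + m * |J|, origin + (m + 1) * |J|)`. -/
noncomputable def interval (D : Lattice) (J : Index) : Set ℝ :=
  Ico (D.origin + J.2 * D.length J) (D.origin + (J.2 + 1) * D.length J)

end Lattice

/-- The left half `J⁻`. -/
def leftHalf (J : Index) : Index := (J.1 - 1, 2 * J.2)

/-- The right half `J⁺`. -/
def rightHalf (J : Index) : Index := (J.1 - 1, 2 * J.2 + 1)

/-- A weight: a locally integrable function on the line that is positive almost everywhere. -/
def IsWeight (w : ℝ → ℝ) : Prop :=
  LocallyIntegrable w volume ∧ ∀ᵐ x ∂(volume : Measure ℝ), 0 < w x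

/-- The characteristic `[w] = sup_J ⟨w⟩_J ⟨w⁻¹⟩_J`, with values in `[0, ∞]`. -/
noncomputable def a2Char (D : Lattice) (w : ℝ → ℝ) : ℝ≥0∞ :=
  ⨆ J : Index, (⨍⁻ x in D.interval J, ENNReal.ofReal (w x) ∂volume) *
    (⨍⁻ x in D.interval J, ENNReal.ofReal ((w x)⁻¹) ∂volume)

/-- The dyadic Muckenhoupt class `A₂ᵈ`. -/
def MemA2 (D : Lattice) (w : ℝ → ℝ) : Prop :=
  IsWeight w ∧ a2Char D w < ∞

/-- The average `⟨w⟩_J`. -/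
noncomputable def avg (D : Lattice) (w : ℝ → ℝ) (J : Index) : ℝ :=
  ⨍ x in D.interval J, w x

/-- The difference `Δ_J w = ⟨w⟩_{J⁻} - ⟨w⟩_{J⁺}`. -/
noncomputable def diff (D : Lattice) (w : ℝ → ℝ) (J : Index) : ℝ :=
  avg D w (leftHalf J) - avg D w (rightHalf J)

/-- The sequence `c_J^Φ(w)`. Here `w⁻¹` is the pointwise inverse `x ↦ (w x)⁻¹`. -/
noncomputable def cSeq (D : Lattice) (Φ : ℝ → ℝ) (w : ℝ → ℝ) (J : Index) : ℝ :=
  D.length J * Φ (avg D w J * avg D w⁻¹ J) *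
    ((diff D w J) ^ 2 / (avg D w J) ^ 2 + (diff D w⁻¹ J) ^ 2 / (avg D w⁻¹ J) ^ 2)

/-- The Carleson norm of a non-negative sequence, with values in `[0, ∞]`: the least `C` such that
`|I|⁻¹ ∑_{J ∈ 𝒟(I)} c_J ≤ C` for all dyadic `I`. -/
noncomputable def carlesonNorm (D : Lattice) (c : Index → ℝ) : ℝ≥0∞ :=
  ⨆ I : Index, (∑' J : {J : Index // D.interval J ⊆ D.interval I}, ENNReal.ofReal (c J)) /
    ENNReal.ofReal (D.length I)

/-- Carleson sequences: non-negative with finite Carleson norm. -/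
def IsCarleson (D : Lattice) (c : Index → ℝ) : Prop :=
  (∀ J, 0 ≤ c J) ∧ carlesonNorm D c < ∞

/-- `u(Q) = (8 / Q) ∫₁^Q Φ(t) dt`. -/
noncomputable def uFun (Φ : ℝ → ℝ) (Q : ℝ) : ℝ := 8 / Q * ∫ t in (1 : ℝ)..Q, Φ t

/-- `v(y) = sup {Q ≥ 1 : u(Q) ≤ y}`. It is the inverse of `u : [1, ∞) → [0, ∞)` whenever `u` is
invertible; if `Φ` vanishes on an interval `[1, a)`, then `u` is not injective at the value `0` only,
and the formula selects the largest preimage there. -/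
noncomputable def vFun (Φ : ℝ → ℝ) (y : ℝ) : ℝ := sSup {Q : ℝ | 1 ≤ Q ∧ uFun Φ Q ≤ y}

end DyadicA2

namespace DyadicA2

/-! Combinatorics of the lattice -/

/-- The `k`-th interval of the `n`-th generation below `I`. -/
def descendant (I : Index) (n k : ℕ) : Index := (I.1 - n, 2 ^ n * I.2 + k)

lemma descendant_zero (I : Index) : descendant I 0 0 = I := by simp [descendant]

lemma leftHalf_descendant (I : Index) (n k : ℕ) :
    leftHalf (descendant I n k) = descendant I (n + 1) (2 * k) := by
  simp only [leftHalf, descendant, Prod.mk.injEq]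
  constructor
  · push_cast; ring
  · push_cast; ring

lemma rightHalf_descendant (I : Index) (n k : ℕ) :
    rightHalf (descendant I n k) = descendant I (n + 1) (2 * k + 1) := by
  simp only [rightHalf, descendant, Prod.mk.injEq]
  constructor
  · push_cast; ring
  · push_cast; ring

lemma sum_range_two_mul {M : Type*} [AddCommMonoid M] (f : ℕ → M) (m : ℕ) :
    ∑ k ∈ Finset.range (2 * m), f k = ∑ k ∈ Finset.range m, (f (2 * k) + f (2 * k + 1)) := by
  induction m with
  | zero => simp
  | succ m ih =>
    rw [show 2 * (m + 1) = 2 * m + 1 + 1 by ring, Finset.sum_range_succ, Finset.sum_range_succ, ih,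
      Finset.sum_range_succ, add_assoc]

/-- The sum of `f` over the `n`-th generation below `I`. -/
def genSum {M : Type*} [AddCommMonoid M] (f : Index → M) (I : Index) (n : ℕ) : M :=
  ∑ k ∈ Finset.range (2 ^ n), f (descendant I n k)

lemma genSum_zero {M : Type*} [AddCommMonoid M] (f : Index → M) (I : Index) :
    genSum f I 0 = f I := by simp [genSum, descendant_zero]

lemma genSum_succ {M : Type*} [AddCommMonoid M] (f : Index → M) (I : Index) (n : ℕ) :
    genSum f I (n + 1) = genSum (fun J => f (leftHalf J) + f (rightHalf J)) I n := by
  simp only [genSum, leftHalf_descendant, rightHalf_descendant]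
  rw [pow_succ', sum_range_two_mul]

lemma genSum_mono {f g : Index → ℝ} (h : ∀ J, f J ≤ g J) (I : Index) (n : ℕ) :
    genSum f I n ≤ genSum g I n := Finset.sum_le_sum fun _ _ => h _

lemma genSum_add (f g : Index → ℝ) (I : Index) (n : ℕ) :
    genSum (fun J => f J + g J) I n = genSum f I n + genSum g I n := Finset.sum_add_distrib

lemma genSum_nonneg {f : Index → ℝ} (h : ∀ J, 0 ≤ f J) (I : Index) (n : ℕ) :
    0 ≤ genSum f I n := Finset.sum_nonneg fun _ _ => h _

lemma genSum_const_mul (r : ℝ) (f : Index → ℝ) (I : Index) (n : ℕ) :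
    genSum (fun J => r * f J) I n = r * genSum f I n := by
  simp only [genSum, Finset.mul_sum]

lemma le_genSum_add_sum {G e : Index → ℝ}
    (h : ∀ J, G J ≤ G (leftHalf J) + G (rightHalf J) + e J) (I : Index) (n : ℕ) :
    G I ≤ genSum G I n + ∑ i ∈ Finset.range n, genSum e I i := by
  induction n with
  | zero => simp [genSum_zero]
  | succ n ih =>
    have := genSum_mono h I n
    rw [genSum_add] at this
    rw [Finset.sum_range_succ, genSum_succ]
    linarith

lemma genSum_of_eq_add {G : Index → ℝ}
    (h : ∀ J, G J = G (leftHalf J) + G (rightHalf J)) (I : Index) (n : ℕ) :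
    genSum G I n = G I := by
  induction n with
  | zero => simp [genSum_zero]
  | succ n ih => rw [genSum_succ, ← ih]; simp only [← h]

namespace Lattice

variable (D : Lattice)

lemma length_pos (J : Index) : 0 < D.length J := mul_pos D.size_pos (zpow_pos two_pos _)

lemma length_leftHalf (J : Index) : D.length (leftHalf J) = D.length J / 2 := by
  simp only [length, leftHalf]
  rw [zpow_sub_one₀ two_ne_zero]; ring

lemma length_rightHalf (J : Index) : D.length (rightHalf J) = D.length J / 2 :=
  D.length_leftHalf J

lemma length_descendant (I : Index) (n k : ℕ) :
    D.length (descendant I n k) = D.length I / 2 ^ n := by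
  simp only [length, descendant]
  rw [zpow_sub₀ two_ne_zero, zpow_natCast]; ring

lemma interval_leftHalf (J : Index) : D.interval (leftHalf J) =
    Ico (D.origin + J.2 * D.length J) (D.origin + J.2 * D.length J + D.length J / 2) := by
  simp only [interval, length_leftHalf]
  simp only [leftHalf]
  congr 1 <;> push_cast <;> ring

lemma interval_rightHalf (J : Index) : D.interval (rightHalf J) =
    Ico (D.origin + J.2 * D.length J + D.length J / 2)
      (D.origin + (J.2 + 1) * D.length J) := by
  simp only [interval, length_rightHalf]
  simp only [rightHalf]
  congr 1 <;> push_cast <;> ring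

lemma interval_eq_union (J : Index) :
    D.interval J = D.interval (leftHalf J) ∪ D.interval (rightHalf J) := by
  have := D.length_pos J
  rw [interval_leftHalf, interval_rightHalf, Ico_union_Ico_eq_Ico, interval] <;> linarith

lemma disjoint_halves (J : Index) :
    Disjoint (D.interval (leftHalf J)) (D.interval (rightHalf J)) := by
  rw [interval_leftHalf, interval_rightHalf]
  exact Ico_disjoint_Ico_same

lemma measurableSet_interval (J : Index) : MeasurableSet (D.interval J) := measurableSet_Ico

lemma volume_interval (J : Index) : volume (D.interval J) = ENNReal.ofReal (D.length J) := by
  rw [interval, Real.volume_Ico]; congr 1; ring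

lemma volume_real_interval (J : Index) : volume.real (D.interval J) = D.length J := by
  rw [Measure.real, volume_interval, ENNReal.toReal_ofReal (D.length_pos J).le]

lemma interval_subset_iff (J I : Index) : D.interval J ⊆ D.interval I ↔
    D.origin + I.2 * D.length I ≤ D.origin + J.2 * D.length J ∧
      D.origin + (J.2 + 1) * D.length J ≤ D.origin + (I.2 + 1) * D.length I := by
  have := D.length_pos J
  exact Ico_subset_Ico_iff (by linarith)

lemma descendant_subset (I : Index) {n k : ℕ} (hk : k < 2 ^ n) :
    D.interval (descendant I n k) ⊆ D.interval I := by
  have hI := D.length_pos I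
  rw [interval_subset_iff, length_descendant]
  have h2 : (0 : ℝ) < 2 ^ n := by positivity
  have hk' : (k : ℝ) + 1 ≤ 2 ^ n := by exact_mod_cast hk
  simp only [descendant]
  push_cast
  constructor
  · have : ((2 : ℝ) ^ n * I.2 + k) * (D.length I / 2 ^ n) =
      I.2 * D.length I + k * (D.length I / 2 ^ n) := by field_simp
    rw [this]
    have : 0 ≤ k * (D.length I / 2 ^ n) := by positivity
    linarith
  · have : ((2 : ℝ) ^ n * I.2 + k + 1) * (D.length I / 2 ^ n) =
      I.2 * D.length I + (k + 1) * (D.length I / 2 ^ n) := by field_simp; ring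
    rw [this]
    have : (k + 1) * (D.length I / 2 ^ n) ≤ 2 ^ n * (D.length I / 2 ^ n) := by gcongr
    have h3 : 2 ^ n * (D.length I / 2 ^ n) = D.length I := by field_simp
    linarith

lemma exists_descendant_of_subset {J I : Index} (h : D.interval J ⊆ D.interval I) :
    ∃ n k : ℕ, k < 2 ^ n ∧ descendant I n k = J := by
  rw [interval_subset_iff] at h
  obtain ⟨h1, h2⟩ := h
  have hJ := D.length_pos J
  have hlen : D.length J ≤ D.length I := by linarith
  have hle : J.1 ≤ I.1 := by
    unfold length at hlen
    exact (zpow_le_zpow_iff_right₀ (by norm_num : (1 : ℝ) < 2)).1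
      (le_of_mul_le_mul_left hlen D.size_pos)
  obtain ⟨n, hn⟩ := Int.eq_ofNat_of_zero_le (sub_nonneg.2 hle)
  have hI : D.length I = 2 ^ n * D.length J := by
    have := D.length_descendant I n 0
    have h3 : D.length (descendant I n 0) = D.length J := by
      simp only [length, descendant]
      rw [show I.1 - (n : ℤ) = J.1 by omega]
    rw [h3] at this
    rw [this]; field_simp
  rw [hI] at h1 h2
  have h1' : (2 ^ n * I.2 : ℤ) ≤ J.2 := by
    have : ((2 : ℝ) ^ n * I.2) * D.length J ≤ J.2 * D.length J := by linarith
    exact_mod_cast le_of_mul_le_mul_right this hJ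
  have h2' : J.2 + 1 ≤ (2 ^ n * (I.2 + 1) : ℤ) := by
    have : ((J.2 : ℝ) + 1) * D.length J ≤ ((2 : ℝ) ^ n * (I.2 + 1)) * D.length J := by linarith
    exact_mod_cast le_of_mul_le_mul_right this hJ
  obtain ⟨k, hk⟩ := Int.eq_ofNat_of_zero_le (sub_nonneg.2 h1')
  refine ⟨n, k, ?_, ?_⟩
  · zify
    linarith
  · ext
    · simp only [descendant]; omega
    · simp only [descendant]; omega

lemma tsum_subset_eq (I : Index) (f : Index → ℝ≥0∞) :
    ∑' J : {J : Index // D.interval J ⊆ D.interval I}, f J = ∑' n : ℕ, genSum f I n := by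
  let φ : (Σ n : ℕ, Fin (2 ^ n)) → {J : Index // D.interval J ⊆ D.interval I} :=
    fun p => ⟨descendant I p.1 p.2, D.descendant_subset I p.2.2⟩
  have hφ : Function.Bijective φ := by
    constructor
    · rintro ⟨n, k⟩ ⟨n', k'⟩ h
      simp only [φ, Subtype.mk.injEq, descendant, Prod.mk.injEq] at h
      obtain ⟨h1, h2⟩ := h
      obtain rfl : n = n' := by omega
      have : k = k' := by ext; omega
      rw [this]
    · rintro ⟨J, hJ⟩
      obtain ⟨n, k, hk, h⟩ := D.exists_descendant_of_subset hJ
      exact ⟨⟨n, k, hk⟩, Subtype.ext h⟩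
  rw [← (Equiv.ofBijective φ hφ).tsum_eq, ENNReal.tsum_sigma']
  refine tsum_congr fun n => ?_
  rw [tsum_fintype, genSum, ← Fin.sum_univ_eq_sum_range]
  rfl

end Lattice

lemma carlesonNorm_le_iff (D : Lattice) {c : Index → ℝ} (hc : ∀ J, 0 ≤ c J) {B : ℝ} (hB : 0 ≤ B) :
    carlesonNorm D c ≤ ENNReal.ofReal B ↔
      ∀ I n, ∑ i ∈ Finset.range n, genSum c I i ≤ B * D.length I := by
  unfold carlesonNorm
  rw [iSup_le_iff]
  refine forall_congr' fun I => ?_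
  have hI := D.length_pos I
  rw [ENNReal.div_le_iff (by simpa using hI) ENNReal.ofReal_ne_top, ← ENNReal.ofReal_mul hB,
    D.tsum_subset_eq I (fun J => ENNReal.ofReal (c J)), ENNReal.tsum_eq_iSup_nat, iSup_le_iff]
  refine forall_congr' fun n => ?_
  have : ∑ i ∈ Finset.range n, genSum (fun J => ENNReal.ofReal (c J)) I i =
      ENNReal.ofReal (∑ i ∈ Finset.range n, genSum c I i) := by
    rw [ENNReal.ofReal_sum_of_nonneg fun i _ => genSum_nonneg hc I i]
    refine Finset.sum_congr rfl fun i _ => ?_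
    rw [genSum, genSum, ENNReal.ofReal_sum_of_nonneg fun _ _ => hc _]
  rw [this, ENNReal.ofReal_le_ofReal_iff (by positivity)]

end DyadicA2

namespace DyadicA2

/-! Averages of weights -/

/-- Almost everywhere positive functions that are integrable on the intervals of the lattice. -/
structure DyadicWeight (D : Lattice) (w : ℝ → ℝ) : Prop where
  pos : ∀ᵐ x ∂(volume : Measure ℝ), 0 < w x
  integrableOn : ∀ J, IntegrableOn w (D.interval J)

lemma IsWeight.dyadicWeight {w : ℝ → ℝ} (hw : IsWeight w) (D : Lattice) : DyadicWeight D w :=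
  ⟨hw.2, fun _ => (hw.1.integrableOn_isCompact isCompact_Icc).mono_set Ico_subset_Icc_self⟩

section

variable {D : Lattice} {w : ℝ → ℝ}

lemma length_mul_avg (D : Lattice) (w : ℝ → ℝ) (J : Index) :
    D.length J * avg D w J = ∫ x in D.interval J, w x := by
  have := D.length_pos J
  rw [avg, setAverage_eq, D.volume_real_interval, smul_eq_mul]
  field_simp

lemma DyadicWeight.avg_pos (hw : DyadicWeight D w) (J : Index) : 0 < avg D w J := by
  have hJ := D.length_pos J
  have h : 0 < ∫ x in D.interval J, w x := by
    rw [setIntegral_pos_iff_support_of_nonneg_ae (ae_restrict_of_ae (hw.pos.mono fun _ h => h.le))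
      (hw.integrableOn J)]
    have : volume (D.interval J) ≤ volume (Function.support w ∩ D.interval J) := by
      refine measure_mono_ae ?_
      filter_upwards [hw.pos] with x hx hxJ using ⟨hx.ne', hxJ⟩
    refine lt_of_lt_of_le ?_ this
    rw [D.volume_interval]; simpa using hJ
  rw [← length_mul_avg] at h
  exact pos_of_mul_pos_right h hJ.le

lemma integral_eq_add_halves {f : ℝ → ℝ} {J : Index} (hf : IntegrableOn f (D.interval J)) :
    ∫ x in D.interval J, f x =
      (∫ x in D.interval (leftHalf J), f x) + ∫ x in D.interval (rightHalf J), f x := by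
  rw [D.interval_eq_union J] at hf ⊢
  exact setIntegral_union (D.disjoint_halves J) (D.measurableSet_interval _)
    (hf.mono_set subset_union_left) (hf.mono_set subset_union_right)

lemma DyadicWeight.avg_eq (hw : DyadicWeight D w) (J : Index) :
    avg D w J = (avg D w (leftHalf J) + avg D w (rightHalf J)) / 2 := by
  have hJ := D.length_pos J
  have h := integral_eq_add_halves (hw.integrableOn J)
  rw [← length_mul_avg, ← length_mul_avg, ← length_mul_avg, D.length_leftHalf,
    D.length_rightHalf] at h
  have : D.length J * (avg D w J - (avg D w (leftHalf J) + avg D w (rightHalf J)) / 2) = 0 := by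
    linarith
  rcases mul_eq_zero.1 this with h | h <;> linarith

/-- Half of the relative difference `Δ_J w / ⟨w⟩_J`. -/
noncomputable def relDiff (D : Lattice) (w : ℝ → ℝ) (J : Index) : ℝ :=
  diff D w J / (2 * avg D w J)

lemma DyadicWeight.avg_leftHalf (hw : DyadicWeight D w) (J : Index) :
    avg D w (leftHalf J) = avg D w J * (1 + relDiff D w J) := by
  have h := hw.avg_eq J
  have := (hw.avg_pos J).ne'
  rw [relDiff, mul_add, ← mul_div_assoc, mul_comm (avg D w J) (diff D w J),
    mul_div_mul_right _ _ this, diff]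
  linarith

lemma DyadicWeight.avg_rightHalf (hw : DyadicWeight D w) (J : Index) :
    avg D w (rightHalf J) = avg D w J * (1 - relDiff D w J) := by
  have h := hw.avg_eq J
  have := hw.avg_leftHalf J
  linarith

lemma DyadicWeight.abs_relDiff_lt (hw : DyadicWeight D w) (J : Index) :
    |relDiff D w J| < 1 := by
  have h := hw.avg_pos J
  have h1 := hw.avg_pos (leftHalf J)
  have h2 := hw.avg_pos (rightHalf J)
  rw [hw.avg_leftHalf] at h1
  rw [hw.avg_rightHalf] at h2
  have h1' := pos_of_mul_pos_right h1 h.le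
  have h2' := pos_of_mul_pos_right h2 h.le
  rw [abs_lt]; constructor <;> linarith

/-- The product `⟨w⟩_J ⟨w⁻¹⟩_J`. -/
noncomputable def avgProd (D : Lattice) (w : ℝ → ℝ) (J : Index) : ℝ := avg D w J * avg D w⁻¹ J

lemma DyadicWeight.avgProd_pos (hw : DyadicWeight D w) (hw' : DyadicWeight D w⁻¹) (J : Index) :
    0 < avgProd D w J := mul_pos (hw.avg_pos J) (hw'.avg_pos J)

lemma DyadicWeight.one_le_avgProd (hw : DyadicWeight D w) (hw' : DyadicWeight D w⁻¹) (J : Index) :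
    1 ≤ avgProd D w J := by
  have hJ := D.length_pos J
  have hA := hw.avg_pos J
  set A := avg D w J with hAdef
  have hfin : volume (D.interval J) ≠ ∞ := by rw [D.volume_interval]; exact ENNReal.ofReal_ne_top
  have hc : IntegrableOn (fun _ : ℝ => 2 / A) (D.interval J) := integrableOn_const hfin
  have hint : IntegrableOn (fun x => w x / A ^ 2) (D.interval J) := (hw.integrableOn J).div_const _
  have h : ∫ x in D.interval J, (2 / A - w x / A ^ 2) ≤ ∫ x in D.interval J, w⁻¹ x := by
    refine integral_mono_ae (hc.sub hint) (hw'.integrableOn J) (ae_restrict_of_ae ?_)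
    filter_upwards [hw.pos] with x hx
    simp only [Pi.inv_apply]
    have : (w x)⁻¹ - (2 / A - w x / A ^ 2) = (w x - A) ^ 2 / (A ^ 2 * w x) := by
      field_simp; ring
    have h2 : 0 ≤ (w x - A) ^ 2 / (A ^ 2 * w x) := by positivity
    linarith
  rw [integral_sub hc hint, setIntegral_const, integral_div, ← length_mul_avg, ← length_mul_avg,
    D.volume_real_interval, ← hAdef, smul_eq_mul] at h
  have h3 : D.length J * (2 / A) - D.length J * A / A ^ 2 = D.length J * (1 / A) := by
    field_simp; ring
  rw [h3] at h
  have h4 := le_of_mul_le_mul_left h hJ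
  rw [div_le_iff₀ hA] at h4
  rw [avgProd]; linarith

lemma DyadicWeight.avgProd_leftHalf (hw : DyadicWeight D w) (hw' : DyadicWeight D w⁻¹)
    (J : Index) : avgProd D w (leftHalf J) =
      avgProd D w J * ((1 + relDiff D w J) * (1 + relDiff D w⁻¹ J)) := by
  rw [avgProd, hw.avg_leftHalf, hw'.avg_leftHalf, avgProd]; ring

lemma DyadicWeight.avgProd_rightHalf (hw : DyadicWeight D w) (hw' : DyadicWeight D w⁻¹)
    (J : Index) : avgProd D w (rightHalf J) =
      avgProd D w J * ((1 - relDiff D w J) * (1 - relDiff D w⁻¹ J)) := by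
  rw [avgProd, hw.avg_rightHalf, hw'.avg_rightHalf, avgProd]; ring

lemma DyadicWeight.cSeq_eq (hw : DyadicWeight D w) (hw' : DyadicWeight D w⁻¹) (Φ : ℝ → ℝ)
    (J : Index) : cSeq D Φ w J = D.length J * Φ (avgProd D w J) *
      (4 * (relDiff D w J ^ 2 + relDiff D w⁻¹ J ^ 2)) := by
  have h1 := hw.avg_pos J
  have h2 := hw'.avg_pos J
  rw [cSeq, avgProd, relDiff, relDiff]
  congr 1
  field_simp
  ring

lemma DyadicWeight.cSeq_nonneg (hw : DyadicWeight D w) (hw' : DyadicWeight D w⁻¹) {Φ : ℝ → ℝ}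
    (hΦ : ∀ t ∈ Ici (1 : ℝ), 0 ≤ Φ t) (J : Index) : 0 ≤ cSeq D Φ w J := by
  rw [hw.cSeq_eq hw']
  have := hΦ _ (hw.one_le_avgProd hw' J)
  have := D.length_pos J
  positivity

lemma setLAverage_ofReal (hw : DyadicWeight D w) (J : Index) :
    ⨍⁻ x in D.interval J, ENNReal.ofReal (w x) ∂volume = ENNReal.ofReal (avg D w J) := by
  have hJ := D.length_pos J
  rw [setLAverage_eq, ← ofReal_integral_eq_lintegral_ofReal (hw.integrableOn J)
    (ae_restrict_of_ae (hw.pos.mono fun _ h => h.le)), D.volume_interval,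
    ← ENNReal.ofReal_div_of_pos hJ, ← length_mul_avg]
  congr 1
  field_simp

lemma DyadicWeight.a2Char_eq (hw : DyadicWeight D w) (hw' : DyadicWeight D w⁻¹) :
    a2Char D w = ⨆ J, ENNReal.ofReal (avgProd D w J) := by
  refine iSup_congr fun J => ?_
  rw [avgProd, ENNReal.ofReal_mul (hw.avg_pos J).le, setLAverage_ofReal hw,
    ← setLAverage_ofReal hw']
  rfl

lemma DyadicWeight.a2Char_le (hw : DyadicWeight D w) (hw' : DyadicWeight D w⁻¹) {B : ℝ}
    (h : ∀ J, avgProd D w J ≤ B) : a2Char D w ≤ ENNReal.ofReal B := by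
  rw [hw.a2Char_eq hw']
  exact iSup_le fun J => ENNReal.ofReal_le_ofReal (h J)

lemma DyadicWeight.ofReal_avgProd_le (hw : DyadicWeight D w) (hw' : DyadicWeight D w⁻¹)
    (J : Index) : ENNReal.ofReal (avgProd D w J) ≤ a2Char D w := by
  rw [hw.a2Char_eq hw']
  exact le_iSup (fun J => ENNReal.ofReal (avgProd D w J)) J

lemma DyadicWeight.avgProd_le (hw : DyadicWeight D w) (hw' : DyadicWeight D w⁻¹)
    (h : a2Char D w < ∞) (J : Index) : avgProd D w J ≤ (a2Char D w).toReal :=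
  (ENNReal.ofReal_le_iff_le_toReal h.ne).1 (hw.ofReal_avgProd_le hw' J)

lemma MemA2.dyadicWeight_inv (h : MemA2 D w) : DyadicWeight D w⁻¹ := by
  have hw := h.1.dyadicWeight D
  refine ⟨hw.pos.mono fun x hx => inv_pos.2 hx, fun J => ?_⟩
  have h1 : (⨍⁻ x in D.interval J, ENNReal.ofReal (w x) ∂volume) *
    (⨍⁻ x in D.interval J, ENNReal.ofReal ((w x)⁻¹) ∂volume) < ∞ :=
    (le_iSup (fun J => (⨍⁻ x in D.interval J, ENNReal.ofReal (w x) ∂volume) *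
    (⨍⁻ x in D.interval J, ENNReal.ofReal ((w x)⁻¹) ∂volume)) J).trans_lt h.2
  rw [setLAverage_ofReal hw] at h1
  have h2 : ⨍⁻ x in D.interval J, ENNReal.ofReal ((w x)⁻¹) ∂volume < ∞ := by
    by_contra h3
    rw [not_lt, top_le_iff] at h3
    rw [h3, ENNReal.mul_top (by simpa using hw.avg_pos J)] at h1
    exact lt_irrefl _ h1
  have h3 : ∫⁻ x in D.interval J, ENNReal.ofReal ((w x)⁻¹) ∂volume < ∞ := by
    rw [setLAverage_eq] at h2
    by_contra h4
    rw [not_lt, top_le_iff] at h4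
    rw [h4, D.volume_interval, ENNReal.top_div_of_ne_top ENNReal.ofReal_ne_top] at h2
    exact lt_irrefl _ h2
  have hm : AEStronglyMeasurable w⁻¹ (volume.restrict (D.interval J)) :=
    (hw.integrableOn J).aemeasurable.inv.aestronglyMeasurable
  exact ⟨hm, (hasFiniteIntegral_iff_ofReal
    (ae_restrict_of_ae (hw.pos.mono fun x hx => (inv_pos.2 hx).le))).2 h3⟩

end

/-! The estimate for dyadic `A₂` weights -/

lemma sq_add_sq_le_neg_log {a b : ℝ} (ha : |a| < 1) (hb : |b| < 1) :
    a ^ 2 + b ^ 2 ≤ -(Real.log ((1 + a) * (1 + b)) + Real.log ((1 - a) * (1 - b))) := by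
  rw [abs_lt] at ha hb
  have h1 : 0 < 1 + a := by linarith
  have h2 : 0 < 1 - a := by linarith
  have h3 : 0 < 1 + b := by linarith
  have h4 : 0 < 1 - b := by linarith
  have ea := Real.log_le_sub_one_of_pos (mul_pos h1 h2)
  have eb := Real.log_le_sub_one_of_pos (mul_pos h3 h4)
  rw [Real.log_mul h1.ne' h2.ne'] at ea
  rw [Real.log_mul h3.ne' h4.ne'] at eb
  rw [Real.log_mul h1.ne' h3.ne', Real.log_mul h2.ne' h4.ne']
  nlinarith

lemma carlesonNorm_le_of_memA2 {D : Lattice} {w : ℝ → ℝ} {Φ : ℝ → ℝ}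
    (hΦ_nonneg : ∀ t ∈ Ici (1 : ℝ), 0 ≤ Φ t) (hΦ_mono : MonotoneOn Φ (Ici 1)) (h : MemA2 D w) :
    carlesonNorm D (cSeq D Φ w) ≤ ENNReal.ofReal
      (8 * Φ (a2Char D w).toReal * Real.log (a2Char D w).toReal) := by
  have hw := h.1.dyadicWeight D
  have hw' := h.dyadicWeight_inv
  set A := (a2Char D w).toReal
  have hle : ∀ J, avgProd D w J ≤ A := hw.avgProd_le hw' h.2
  have hone := hw.one_le_avgProd hw'
  have hA : 1 ≤ A := (hone (0, 0)).trans (hle _)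
  have hΦA := hΦ_nonneg A hA
  have hlogA := Real.log_nonneg hA
  rw [carlesonNorm_le_iff D (hw.cSeq_nonneg hw' hΦ_nonneg) (by positivity)]
  intro I n
  have key := le_genSum_add_sum
    (G := fun J => -(8 * Φ A * (D.length J * Real.log (avgProd D w J))))
    (e := fun J => -cSeq D Φ w J) (fun J => by
      have hJ := D.length_pos J
      have ha := hw.abs_relDiff_lt J
      have hb := hw'.abs_relDiff_lt J
      have hl := sq_add_sq_le_neg_log ha hb
      rw [hw.cSeq_eq hw', D.length_leftHalf, D.length_rightHalf, hw.avgProd_leftHalf hw',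
        hw.avgProd_rightHalf hw']
      rw [abs_lt] at ha hb
      rw [Real.log_mul (hw.avgProd_pos hw' J).ne'
          (mul_pos (by linarith) (by linarith)).ne',
        Real.log_mul (hw.avgProd_pos hw' J).ne'
          (mul_pos (by linarith) (by linarith)).ne']
      have hΦJ : Φ (avgProd D w J) ≤ Φ A := hΦ_mono (hone J) hA (hle J)
      have h1 : D.length J * Φ (avgProd D w J) *
          (4 * (relDiff D w J ^ 2 + relDiff D w⁻¹ J ^ 2)) ≤ D.length J * Φ A *
          (4 * (relDiff D w J ^ 2 + relDiff D w⁻¹ J ^ 2)) := by gcongr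
      have h2 := mul_le_mul_of_nonneg_left hl (by positivity : 0 ≤ D.length J * Φ A * 4)
      linarith) I n
  have hneg : genSum (fun J => -(8 * Φ A * (D.length J * Real.log (avgProd D w J)))) I n ≤ 0 :=
    Finset.sum_nonpos fun k _ => by
      have := D.length_pos (descendant I n k)
      have := Real.log_nonneg (hone (descendant I n k))
      have : 0 ≤ 8 * Φ A * (D.length (descendant I n k) *
        Real.log (avgProd D w (descendant I n k))) := by positivity
      linarith
  have hsum : ∑ i ∈ Finset.range n, genSum (fun J => -cSeq D Φ w J) I i =
      -∑ i ∈ Finset.range n, genSum (cSeq D Φ w) I i := by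
    simp only [genSum, Finset.sum_neg_distrib]
  have hlog : Real.log (avgProd D w I) ≤ Real.log A :=
    Real.log_le_log (hw.avgProd_pos hw' I) (hle I)
  have h3 : 8 * Φ A * (D.length I * Real.log (avgProd D w I)) ≤
      8 * Φ A * (D.length I * Real.log A) := by
    have := D.length_pos I
    gcongr
  rw [hsum] at key
  linarith

end DyadicA2

namespace DyadicA2

/-! Lebesgue differentiation along the lattice -/

/-- The interval of generation `k` that contains `x`. -/
noncomputable def intervalAt (D : Lattice) (k : ℤ) (x : ℝ) : Index :=
  (k, ⌊(x - D.origin) / D.length (k, 0)⌋)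

section

variable {D : Lattice} {w : ℝ → ℝ}

lemma intervalAt_eq {J : Index} {x : ℝ} (hx : x ∈ D.interval J) : intervalAt D J.1 x = J := by
  have hJ := D.length_pos J
  have hl : D.length (J.1, 0) = D.length J := rfl
  rw [Lattice.interval, mem_Ico] at hx
  unfold intervalAt
  ext
  · rfl
  · simp only [hl]
    rw [Int.floor_eq_iff, le_div_iff₀ hJ, div_lt_iff₀ hJ]
    constructor <;> linarith

lemma mem_interval_intervalAt (k : ℤ) (x : ℝ) : x ∈ D.interval (intervalAt D k x) := by
  have hJ := D.length_pos (k, 0)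
  have hl : D.length (intervalAt D k x) = D.length (k, 0) := rfl
  rw [Lattice.interval, mem_Ico, hl]
  simp only [intervalAt]
  have h1 := Int.floor_le ((x - D.origin) / D.length (k, 0))
  have h2 := Int.lt_floor_add_one ((x - D.origin) / D.length (k, 0))
  rw [le_div_iff₀ hJ] at h1
  rw [div_lt_iff₀ hJ] at h2
  constructor <;> linarith

lemma measurable_comp_intervalAt (k : ℤ) (f : Index → ℝ) :
    Measurable fun x => f (intervalAt D k x) := by
  have h1 : Measurable fun x : ℝ => ⌊(x - D.origin) / D.length (k, 0)⌋ :=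
    ((measurable_id.sub_const _).div_const _).floor
  exact (measurable_from_top (f := fun m : ℤ => f (k, m))).comp h1

lemma genSum_length_mul_eq_integral (f : Index → ℝ) {B : ℝ} (hB : ∀ J, |f J| ≤ B) (I : Index)
    (n : ℕ) : genSum (fun J => D.length J * f J) I n =
      ∫ x in D.interval I, f (intervalAt D (I.1 - n) x) := by
  have hint : ∀ J, IntegrableOn (fun x => f (intervalAt D (I.1 - n) x)) (D.interval J) := fun J =>
    Measure.integrableOn_of_bounded (M := B)
      (by rw [D.volume_interval]; exact ENNReal.ofReal_ne_top)
      (measurable_comp_intervalAt _ f).aestronglyMeasurable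
      (Eventually.of_forall fun x => by simpa using hB _)
  rw [← genSum_of_eq_add
    (G := fun J => ∫ x in D.interval J, f (intervalAt D (I.1 - n) x))
    (fun J => integral_eq_add_halves (hint J)) I n]
  refine Finset.sum_congr rfl fun k _ => ?_
  have : ∫ x in D.interval (descendant I n k), f (intervalAt D (I.1 - n) x) =
      ∫ x in D.interval (descendant I n k), f (descendant I n k) := by
    refine setIntegral_congr_fun (D.measurableSet_interval _) fun x hx => ?_
    exact congrArg f (intervalAt_eq hx)
  simp only
  rw [this, setIntegral_const, D.volume_real_interval, smul_eq_mul]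

lemma tendsto_length_intervalAt (k : ℤ) (x : ℝ) :
    Tendsto (fun n : ℕ => D.length (intervalAt D (k - n) x)) atTop (nhds 0) := by
  have : ∀ n : ℕ, D.length (intervalAt D (k - n) x) = D.length (k, 0) * (1 / 2) ^ n := fun n => by
    simp only [Lattice.length, intervalAt]
    rw [zpow_sub₀ two_ne_zero, zpow_natCast, one_div, inv_pow]; ring
  simp only [this]
  simpa using (tendsto_pow_atTop_nhds_zero_of_lt_one (by norm_num : (0 : ℝ) ≤ 1 / 2)
    (by norm_num)).const_mul (D.length (k, 0))

lemma ae_tendsto_avg_intervalAt (hw : LocallyIntegrable w volume) (k : ℤ) :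
    ∀ᵐ x, Tendsto (fun n : ℕ => avg D w (intervalAt D (k - n) x)) atTop (nhds (w x)) := by
  filter_upwards [IsUnifLocDoublingMeasure.ae_tendsto_average (μ := volume) hw 1] with x hx
  let δ : ℕ → ℝ := fun n => D.length (intervalAt D (k - n) x) / 2
  let c : ℕ → ℝ := fun n => D.origin + (intervalAt D (k - n) x).2 *
    D.length (intervalAt D (k - n) x) + δ n
  have hball : ∀ n, Metric.closedBall (c n) (δ n) =
      Icc (D.origin + (intervalAt D (k - n) x).2 * D.length (intervalAt D (k - n) x))
        (D.origin + ((intervalAt D (k - n) x).2 + 1) * D.length (intervalAt D (k - n) x)) :=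
    fun n => by
      rw [Real.closedBall_eq_Icc]
      congr 1 <;> simp only [c, δ] <;> ring
  have h := hx c δ (l := atTop) ?_ ?_
  · refine h.congr fun n => ?_
    rw [hball, avg, Lattice.interval]
    exact setAverage_congr Ico_ae_eq_Icc.symm
  · rw [tendsto_nhdsWithin_iff]
    constructor
    · simpa using (tendsto_length_intervalAt (D := D) k x).div_const 2
    · exact Eventually.of_forall fun n => half_pos (D.length_pos _)
  · refine Eventually.of_forall fun n => ?_
    rw [one_mul, hball]
    exact Ico_subset_Icc_self (mem_interval_intervalAt (D := D) (k - n) x)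

lemma tendsto_genSum_zero (hw : IsWeight w) (hw' : IsWeight w⁻¹) {F : ℝ → ℝ}
    (hF : ContinuousAt F 1) (hF1 : F 1 = 0) {B : ℝ} (hB : ∀ J, |F (avgProd D w J)| ≤ B)
    (I : Index) :
    Tendsto (genSum (fun J => D.length J * F (avgProd D w J)) I) atTop (nhds 0) := by
  have heq : genSum (fun J => D.length J * F (avgProd D w J)) I = fun n : ℕ =>
      ∫ x in D.interval I, F (avgProd D w (intervalAt D (I.1 - n) x)) := by
    ext n
    exact genSum_length_mul_eq_integral (fun J => F (avgProd D w J)) hB I n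
  rw [heq]
  have h0 : (0 : ℝ) = ∫ x in D.interval I, (0 : ℝ) := by simp
  rw [h0]
  refine tendsto_integral_of_dominated_convergence (fun _ => B) (fun n => ?_) ?_ (fun n => ?_) ?_
  · exact (measurable_comp_intervalAt _ fun J => F (avgProd D w J)).aestronglyMeasurable
  · exact integrableOn_const (by rw [D.volume_interval]; exact ENNReal.ofReal_ne_top)
  · exact Eventually.of_forall fun x => by simpa using hB _
  · refine ae_restrict_of_ae ?_
    filter_upwards [hw.2, ae_tendsto_avg_intervalAt (D := D) hw.1 I.1,
      ae_tendsto_avg_intervalAt (D := D) hw'.1 I.1] with x hx h1 h2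
    have h3 := h1.mul h2
    rw [Pi.inv_apply, mul_inv_cancel₀ hx.ne'] at h3
    have := hF.tendsto.comp h3
    rwa [hF1] at this

/-- The Bellman function principle: a function `F` of `⟨w⟩_J ⟨w⁻¹⟩_J` whose defect of midpoint
convexity is dominated by a Carleson sequence is dominated by the Carleson norm. -/
lemma le_mul_carlesonNorm (hw : IsWeight w) (hw' : IsWeight w⁻¹) {F : ℝ → ℝ}
    (hF : ContinuousAt F 1) (hF1 : F 1 = 0) {B : ℝ} (hB : ∀ J, |F (avgProd D w J)| ≤ B)
    {c : Index → ℝ} (hc : IsCarleson D c) {K : ℝ} (hK : 0 ≤ K)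
    (hstep : ∀ J, D.length J * F (avgProd D w J) ≤ D.length J *
      ((F (avgProd D w (leftHalf J)) + F (avgProd D w (rightHalf J))) / 2) + K * c J)
    (I : Index) : F (avgProd D w I) ≤ K * (carlesonNorm D c).toReal := by
  have hI := D.length_pos I
  have hsum := (carlesonNorm_le_iff D hc.1 ENNReal.toReal_nonneg).1
    (ENNReal.ofReal_toReal hc.2.ne).ge I
  have key : ∀ n, D.length I * F (avgProd D w I) ≤
      genSum (fun J => D.length J * F (avgProd D w J)) I n +
        K * ((carlesonNorm D c).toReal * D.length I) := fun n => by
    have h := le_genSum_add_sum (G := fun J => D.length J * F (avgProd D w J))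
      (e := fun J => K * c J) (fun J => by
        have := hstep J
        rw [D.length_leftHalf, D.length_rightHalf]
        linarith) I n
    simp only [genSum_const_mul, ← Finset.mul_sum] at h
    have := mul_le_mul_of_nonneg_left (hsum n) hK
    linarith
  have hlim := ge_of_tendsto' ((tendsto_genSum_zero hw hw' hF hF1 hB I).add_const _) key
  rw [zero_add] at hlim
  refine le_of_mul_le_mul_left (hlim.trans_eq ?_) hI
  ring

end

end DyadicA2

namespace DyadicA2

/-! The functions `u` and `v` -/

/-- The primitive of `Φ` based at `1`, with `Φ` extended by `Φ 1` to the left of `1`. -/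
noncomputable def primitive (Φ : ℝ → ℝ) (Q : ℝ) : ℝ := ∫ t in (1 : ℝ)..Q, Φ (max t 1)

section

variable {Φ : ℝ → ℝ}

lemma monotone_extend (h : MonotoneOn Φ (Ici 1)) : Monotone fun t => Φ (max t 1) :=
  fun _ _ hst => h (mem_Ici.2 (le_max_right _ _)) (mem_Ici.2 (le_max_right _ _))
    (max_le_max_right 1 hst)

lemma primitive_sub (h : MonotoneOn Φ (Ici 1)) (s t : ℝ) :
    primitive Φ t - primitive Φ s = ∫ x in s..t, Φ (max x 1) :=
  intervalIntegral.integral_interval_sub_left (monotone_extend h).intervalIntegrable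
    (monotone_extend h).intervalIntegrable

lemma primitive_tangent (h : MonotoneOn Φ (Ici 1)) {s : ℝ} (hs : 1 ≤ s) (t : ℝ) :
    primitive Φ s + Φ s * (t - s) ≤ primitive Φ t := by
  have hm := monotone_extend h
  have hs' : max s 1 = s := max_eq_left hs
  rcases le_total s t with hst | hst
  · have h1 : ∫ x in s..t, Φ s ≤ ∫ x in s..t, Φ (max x 1) :=
      intervalIntegral.integral_mono_on hst intervalIntegrable_const hm.intervalIntegrable
        fun x hx => by simpa only [hs'] using hm hx.1
    rw [intervalIntegral.integral_const, smul_eq_mul, ← primitive_sub h] at h1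
    linarith
  · have h1 : ∫ x in t..s, Φ (max x 1) ≤ ∫ x in t..s, Φ s :=
      intervalIntegral.integral_mono_on hst hm.intervalIntegrable intervalIntegrable_const
        fun x hx => by simpa only [hs'] using hm hx.2
    rw [intervalIntegral.integral_const, smul_eq_mul, ← primitive_sub h] at h1
    linarith

lemma continuous_primitive (h : MonotoneOn Φ (Ici 1)) : Continuous (primitive Φ) :=
  intervalIntegral.continuous_primitive (fun _ _ => (monotone_extend h).intervalIntegrable) 1

lemma primitive_one (Φ : ℝ → ℝ) : primitive Φ 1 = 0 := by simp [primitive]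

lemma primitive_nonneg (h0 : ∀ t ∈ Ici (1 : ℝ), 0 ≤ Φ t) (h : MonotoneOn Φ (Ici 1)) {Q : ℝ}
    (hQ : 1 ≤ Q) : 0 ≤ primitive Φ Q := by
  have h1 := primitive_tangent h le_rfl Q
  have h2 := mul_nonneg (h0 1 (mem_Ici.2 le_rfl)) (sub_nonneg.2 hQ)
  rw [primitive_one] at h1
  linarith

lemma primitive_mono (h0 : ∀ t ∈ Ici (1 : ℝ), 0 ≤ Φ t) (h : MonotoneOn Φ (Ici 1)) {s t : ℝ}
    (hs : 1 ≤ s) (hst : s ≤ t) : primitive Φ s ≤ primitive Φ t := by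
  have h1 := primitive_tangent h hs t
  have h2 := mul_nonneg (h0 s hs) (sub_nonneg.2 hst)
  linarith

lemma uFun_eq {Q : ℝ} (hQ : 1 ≤ Q) : uFun Φ Q = 8 / Q * primitive Φ Q := by
  rw [uFun, primitive]
  congr 1
  refine intervalIntegral.integral_congr fun t ht => ?_
  rw [uIcc_of_le hQ] at ht
  simp only [max_eq_left ht.1]

lemma uFun_one (Φ : ℝ → ℝ) : uFun Φ 1 = 0 := by simp [uFun]

lemma continuousOn_uFun (h : MonotoneOn Φ (Ici 1)) : ContinuousOn (uFun Φ) (Ici 1) := by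
  have : ContinuousOn (fun Q => 8 / Q * primitive Φ Q) (Ici 1) :=
    (continuousOn_const.div continuousOn_id fun x hx => (zero_lt_one.trans_le hx).ne').mul
      (continuous_primitive h).continuousOn
  exact this.congr fun Q hQ => uFun_eq hQ

lemma uFun_nonneg (h0 : ∀ t ∈ Ici (1 : ℝ), 0 ≤ Φ t) (h : MonotoneOn Φ (Ici 1)) {Q : ℝ}
    (hQ : 1 ≤ Q) : 0 ≤ uFun Φ Q := by
  rw [uFun_eq hQ]
  have := primitive_nonneg h0 h hQ
  positivity

lemma strictMonoOn_uFun (h0 : ∀ t ∈ Ici (1 : ℝ), 0 ≤ Φ t) (h : MonotoneOn Φ (Ici 1))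
    (hpos : ∀ t ∈ Ioi (1 : ℝ), 0 < Φ t) :
    StrictMonoOn (uFun Φ) (Ici 1) := by
  intro s hs t ht hst
  rw [mem_Ici] at hs ht
  have hs0 : 0 < s := by linarith
  have ht0 : 0 < t := by linarith
  rw [uFun_eq hs, uFun_eq ht, div_mul_eq_mul_div, div_mul_eq_mul_div, div_lt_div_iff₀ hs0 ht0]
  rcases hs.eq_or_lt with rfl | hs1
  · have h1 := primitive_tangent h (s := (1 + t) / 2) (by linarith) t
    have hm := hpos ((1 + t) / 2) (by rw [mem_Ioi]; linarith)
    have hm' := mul_pos hm (by linarith : (0 : ℝ) < t - (1 + t) / 2)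
    have h4 := primitive_nonneg h0 h (Q := (1 + t) / 2) (by linarith)
    rw [primitive_one]
    linarith
  · have h1 := primitive_tangent h hs t
    have h2 := primitive_tangent h hs 1
    rw [primitive_one] at h2
    have h3 := mul_pos (hpos s hs1) (sub_pos.2 hst)
    have h4 := mul_le_mul_of_nonneg_left h1 hs0.le
    have h5 := mul_le_mul_of_nonneg_left h2 (sub_pos.2 hst).le
    linarith

lemma tendsto_uFun (h0 : ∀ t ∈ Ici (1 : ℝ), 0 ≤ Φ t) (h : MonotoneOn Φ (Ici 1))
    (htop : Tendsto Φ atTop atTop) : Tendsto (uFun Φ) atTop atTop := by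
  rw [tendsto_atTop]
  intro b
  obtain ⟨T, hT⟩ := eventually_atTop.1 (tendsto_atTop.1 htop (max b 0))
  have hT1 : max b 0 ≤ Φ (max T 1) := hT _ (le_max_left _ _)
  filter_upwards [eventually_ge_atTop (2 * max T 1)] with Q hQ
  have hS : 1 ≤ max T 1 := le_max_right _ _
  set S := max T 1
  have hQ1 : 1 ≤ Q := by linarith
  have hQ0 : 0 < Q := by linarith
  rw [uFun_eq hQ1, div_mul_eq_mul_div, le_div_iff₀ hQ0]
  have h1 := primitive_tangent h hS Q
  have h2 := primitive_nonneg h0 h hS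
  have h3 : b ≤ Φ S := (le_max_left _ _).trans hT1
  have h4 := h0 S hS
  have h5 := mul_le_mul_of_nonneg_left hQ h4
  have h6 := mul_le_mul_of_nonneg_right h3 hQ0.le
  have h7 := mul_nonneg h4 hQ0.le
  linarith

lemma bddAbove_sublevel_uFun (h : Tendsto (uFun Φ) atTop atTop) (y : ℝ) :
    BddAbove {Q : ℝ | 1 ≤ Q ∧ uFun Φ Q ≤ y} := by
  obtain ⟨T, hT⟩ := eventually_atTop.1 (tendsto_atTop.1 h (y + 1))
  refine ⟨T, fun Q hQ => ?_⟩
  by_contra hlt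
  have := hT Q (not_le.1 hlt).le
  linarith [hQ.2]

lemma one_mem_sublevel_uFun (Φ : ℝ → ℝ) {y : ℝ} (hy : 0 ≤ y) :
    (1 : ℝ) ∈ {Q : ℝ | 1 ≤ Q ∧ uFun Φ Q ≤ y} := ⟨le_rfl, by rwa [uFun_one]⟩

lemma one_le_vFun (h : Tendsto (uFun Φ) atTop atTop) {y : ℝ} (hy : 0 ≤ y) : 1 ≤ vFun Φ y :=
  le_csSup (bddAbove_sublevel_uFun h y) (one_mem_sublevel_uFun Φ hy)

lemma uFun_vFun (h : MonotoneOn Φ (Ici 1)) (htop : Tendsto (uFun Φ) atTop atTop) {y : ℝ}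
    (hy : 0 ≤ y) : uFun Φ (vFun Φ y) = y := by
  have hc := continuousOn_uFun h
  have hbdd := bddAbove_sublevel_uFun htop y
  have hclosed : IsClosed {Q : ℝ | 1 ≤ Q ∧ uFun Φ Q ≤ y} :=
    hc.preimage_isClosed_of_isClosed isClosed_Ici isClosed_Iic
  have hmem := hclosed.csSup_mem ⟨1, one_mem_sublevel_uFun Φ hy⟩ hbdd
  by_contra hne
  have hlt : uFun Φ (vFun Φ y) < y := lt_of_le_of_ne hmem.2 hne
  have hv1 : 1 ≤ vFun Φ y := hmem.1
  obtain ⟨S, hS, hS1⟩ :=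
    ((tendsto_atTop.1 htop y).and (eventually_ge_atTop (vFun Φ y))).exists
  obtain ⟨R, hR, hRy⟩ := intermediate_value_Icc hS1
    (hc.mono fun x hx => hv1.trans hx.1) (show y ∈ Icc _ _ from ⟨hlt.le, hS⟩)
  have hRv : R ≤ vFun Φ y := le_csSup hbdd ⟨hv1.trans hR.1, hRy.le⟩
  have : R = vFun Φ y := le_antisymm hRv hR.1
  exact hne (this ▸ hRy)

lemma uFun_bijOn_invOn (h0 : ∀ t ∈ Ici (1 : ℝ), 0 ≤ Φ t) (h : MonotoneOn Φ (Ici 1))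
    (htop : Tendsto (uFun Φ) atTop atTop) (hpos : ∀ t ∈ Ioi (1 : ℝ), 0 < Φ t) :
    BijOn (uFun Φ) (Ici 1) (Ici 0) ∧ InvOn (vFun Φ) (uFun Φ) (Ici 1) (Ici 0) := by
  have hu : MapsTo (uFun Φ) (Ici 1) (Ici 0) := fun Q hQ => uFun_nonneg h0 h hQ
  have hv : MapsTo (vFun Φ) (Ici 0) (Ici 1) := fun y hy => one_le_vFun htop hy
  have hright : RightInvOn (vFun Φ) (uFun Φ) (Ici 0) := fun y hy => uFun_vFun h htop hy
  have hinj := (strictMonoOn_uFun h0 h hpos).injOn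
  have hinv : InvOn (vFun Φ) (uFun Φ) (Ici 1) (Ici 0) :=
    ⟨fun Q hQ => hinj (hv (hu hQ)) hQ (hright (hu hQ)), hright⟩
  exact ⟨hinv.bijOn hu hv, hinv⟩

end

/-! The lower bound for the Carleson norm -/

lemma abs_mul_le (a b : ℝ) : -(a ^ 2 + b ^ 2) / 2 ≤ a * b := by nlinarith [sq_nonneg (a + b)]

/-- A bounded continuous function that vanishes on `(-∞, 1]`, equals `1` on `[2, ∞)`, and whose
midpoint convexity fails at most quadratically. -/
noncomputable def cutoff (q : ℝ) : ℝ := 1 - (max 0 (min 1 (2 - q))) ^ 2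

lemma continuous_cutoff : Continuous cutoff := by unfold cutoff; fun_prop

lemma cutoff_of_le_one {q : ℝ} (hq : q ≤ 1) : cutoff q = 0 := by
  rw [cutoff, min_eq_left (by linarith), max_eq_right zero_le_one]; norm_num

lemma cutoff_of_two_le {q : ℝ} (hq : 2 ≤ q) : cutoff q = 1 := by
  rw [cutoff, max_eq_left ((min_le_right _ _).trans (by linarith))]; norm_num

lemma cutoff_mem_Icc (q : ℝ) : cutoff q ∈ Icc (0 : ℝ) 1 := by
  have h1 : 0 ≤ max 0 (min 1 (2 - q)) := le_max_left _ _
  have h2 : max 0 (min 1 (2 - q)) ≤ 1 := max_le zero_le_one (min_le_left _ _)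
  unfold cutoff
  constructor <;> nlinarith

lemma cutoff_tangent {q r : ℝ} (hq : 1 ≤ q) (hr : 0 ≤ 1 + r) :
    cutoff q + 2 * max 0 (2 - q) * q * r - 4 * r ^ 2 ≤ cutoff (q * (1 + r)) := by
  have hm : max 0 (min 1 (2 - q)) = max 0 (2 - q) := by rw [min_eq_right (by linarith)]
  unfold cutoff
  rw [hm]
  have hle : max 0 (min 1 (2 - q * (1 + r))) ≤ max 0 (2 - q * (1 + r)) :=
    max_le_max_left 0 (min_le_right _ _)
  have hsq : max 0 (min 1 (2 - q * (1 + r))) ^ 2 ≤ max 0 (2 - q * (1 + r)) ^ 2 :=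
    pow_le_pow_left₀ (le_max_left _ _) hle 2
  rcases le_total q 2 with h2 | h2
  · rw [max_eq_right (by linarith : 0 ≤ 2 - q)]
    have h3 : max 0 (2 - q * (1 + r)) ^ 2 ≤ (2 - q * (1 + r)) ^ 2 := by
      rcases le_total 0 (2 - q * (1 + r)) with h4 | h4
      · rw [max_eq_right h4]
      · rw [max_eq_left h4]; nlinarith [sq_nonneg (2 - q * (1 + r))]
    have h5 : q ^ 2 * r ^ 2 ≤ 4 * r ^ 2 := by
      have : q ^ 2 ≤ 4 := by nlinarith
      nlinarith [sq_nonneg r]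
    nlinarith
  · rw [max_eq_left (by linarith : 2 - q ≤ 0)]
    have h3 : max 0 (2 - q * (1 + r)) ^ 2 ≤ 4 * r ^ 2 := by
      rcases le_total 0 (2 - q * (1 + r)) with h4 | h4
      · rw [max_eq_right h4]
        have h5 : 2 - q * (1 + r) ≤ -2 * r := by nlinarith
        nlinarith
      · rw [max_eq_left h4]; nlinarith [sq_nonneg r]
    nlinarith

lemma cutoff_midpoint {q a b : ℝ} (hq : 1 ≤ q) (ha : |a| < 1) (hb : |b| < 1) :
    cutoff q ≤ (cutoff (q * ((1 + a) * (1 + b))) + cutoff (q * ((1 - a) * (1 - b)))) / 2 +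
      11 * (a ^ 2 + b ^ 2) := by
  rw [abs_lt] at ha hb
  have h1 := cutoff_tangent (r := a * b + (a + b)) hq (by nlinarith)
  have h2 := cutoff_tangent (r := a * b - (a + b)) hq (by nlinarith)
  rw [show 1 + (a * b + (a + b)) = (1 + a) * (1 + b) by ring] at h1
  rw [show 1 + (a * b - (a + b)) = (1 - a) * (1 - b) by ring] at h2
  have hm0 : 0 ≤ max 0 (2 - q) * q := mul_nonneg (le_max_left _ _) (by linarith)
  have hm1 : max 0 (2 - q) * q ≤ 1 := by
    rcases le_total 0 (2 - q) with h | h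
    · rw [max_eq_right h]; nlinarith [sq_nonneg (q - 1)]
    · rw [max_eq_left h]; norm_num
  have hab := abs_mul_le a b
  have h3 : -(a ^ 2 + b ^ 2) / 2 ≤ max 0 (2 - q) * q * (a * b) := by
    have := mul_le_mul_of_nonneg_left hab hm0
    nlinarith [sq_nonneg a, sq_nonneg b]
  have h4 : (a * b) ^ 2 ≤ (a ^ 2 + b ^ 2) / 2 := by
    have ha2 : a ^ 2 ≤ 1 := by nlinarith
    have hb2 : b ^ 2 ≤ 1 := by nlinarith
    rw [mul_pow]
    nlinarith [sq_nonneg a, sq_nonneg b]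
  have h5 : (a + b) ^ 2 ≤ 2 * (a ^ 2 + b ^ 2) := by nlinarith [sq_nonneg (a - b)]
  nlinarith

section

variable {D : Lattice} {w : ℝ → ℝ} {Φ : ℝ → ℝ}

lemma exists_avgProd_le (htop : Tendsto Φ atTop atTop)
    (hw : IsWeight w) (hw' : IsWeight w⁻¹) (hc : IsCarleson D (cSeq D Φ w)) :
    ∃ B, ∀ J, avgProd D w J ≤ B := by
  have hd := hw.dyadicWeight D
  have hd' := hw'.dyadicWeight D
  set C := (carlesonNorm D (cSeq D Φ w)).toReal with hC
  have hC0 : 0 ≤ C := ENNReal.toReal_nonneg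
  obtain ⟨T, hT⟩ := eventually_atTop.1
    ((tendsto_atTop.1 htop (11 * C + 1)).and (eventually_ge_atTop (1 : ℝ)))
  have hT1 : 1 ≤ T := (hT T le_rfl).2
  have hT0 : 0 < T := by linarith
  have hM : 0 < 11 * C + 1 := by linarith
  refine ⟨2 * T, fun I => ?_⟩
  have key := le_mul_carlesonNorm (F := fun Q => cutoff (Q / T)) (B := 1)
    (K := 11 / (4 * (11 * C + 1))) hw hw'
    (continuous_cutoff.comp (continuous_id.div_const T)).continuousAt
    (cutoff_of_le_one ((div_le_one hT0).2 hT1))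
    (fun J => by
      have := cutoff_mem_Icc (avgProd D w J / T)
      rw [abs_of_nonneg this.1]; exact this.2)
    hc (by positivity) (fun J => by
      have hJ := D.length_pos J
      rcases le_total (avgProd D w J / T) 1 with hle | hle
      · rw [cutoff_of_le_one hle, mul_zero]
        have h1 := (cutoff_mem_Icc (avgProd D w (leftHalf J) / T)).1
        have h2 := (cutoff_mem_Icc (avgProd D w (rightHalf J) / T)).1
        have h3 := hc.1 J
        positivity
      · have h1 := cutoff_midpoint hle (hd.abs_relDiff_lt J) (hd'.abs_relDiff_lt J)
        have h2 := (hT _ ((one_le_div hT0).1 hle)).1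
        rw [hd.cSeq_eq hd', hd.avgProd_leftHalf hd', hd.avgProd_rightHalf hd', mul_div_right_comm,
          mul_div_right_comm (avgProd D w J) ((1 - relDiff D w J) * _)]
        have h3 : D.length J * (11 * (relDiff D w J ^ 2 + relDiff D w⁻¹ J ^ 2)) ≤
            11 / (4 * (11 * C + 1)) * (D.length J * Φ (avgProd D w J) *
              (4 * (relDiff D w J ^ 2 + relDiff D w⁻¹ J ^ 2))) := by
          calc _ = 11 / (4 * (11 * C + 1)) * (D.length J * (11 * C + 1) *
              (4 * (relDiff D w J ^ 2 + relDiff D w⁻¹ J ^ 2))) := by field_simp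
            _ ≤ _ := by gcongr
        have h4 := mul_le_mul_of_nonneg_left h1 hJ.le
        linarith) I
  by_contra hlt
  push Not at hlt
  rw [cutoff_of_two_le ((le_div_iff₀ hT0).2 hlt.le), ← hC, div_mul_eq_mul_div,
    le_div_iff₀ (by positivity)] at key
  linarith

lemma uFun_a2Char_le (h0 : ∀ t ∈ Ici (1 : ℝ), 0 ≤ Φ t) (h : MonotoneOn Φ (Ici 1))
    (hw : IsWeight w) (hw' : IsWeight w⁻¹) (hA : a2Char D w < ∞)
    (hc : IsCarleson D (cSeq D Φ w)) :
    1 ≤ (a2Char D w).toReal ∧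
      uFun Φ (a2Char D w).toReal ≤ (carlesonNorm D (cSeq D Φ w)).toReal := by
  have hd := hw.dyadicWeight D
  have hd' := hw'.dyadicWeight D
  set C := (carlesonNorm D (cSeq D Φ w)).toReal with hC
  set A := (a2Char D w).toReal with hAdef
  have hle : ∀ J, avgProd D w J ≤ A := hd.avgProd_le hd' hA
  have hone := hd.one_le_avgProd hd'
  have hA1 : 1 ≤ A := (hone (0, 0)).trans (hle _)
  have hA0 : 0 < A := by linarith
  refine ⟨hA1, ?_⟩
  have key : ∀ I, primitive Φ (avgProd D w I) ≤ A / 8 * C :=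
    le_mul_carlesonNorm (B := primitive Φ A) hw hw' (continuous_primitive h).continuousAt
      (primitive_one Φ) (fun J => by
        rw [abs_of_nonneg (primitive_nonneg h0 h (hone J))]
        exact primitive_mono h0 h (hone J) (hle J))
      hc (by positivity) (fun J => by
        have hJ := D.length_pos J
        have hQ := hone J
        have hΦ := h0 _ hQ
        have h1 := primitive_tangent h hQ (avgProd D w (leftHalf J))
        have h2 := primitive_tangent h hQ (avgProd D w (rightHalf J))
        rw [hd.cSeq_eq hd']
        rw [hd.avgProd_leftHalf hd'] at h1 ⊢
        rw [hd.avgProd_rightHalf hd'] at h2 ⊢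
        set a := relDiff D w J
        set b := relDiff D w⁻¹ J
        set Q := avgProd D w J
        have h3 : primitive Φ Q ≤ (primitive Φ (Q * ((1 + a) * (1 + b))) +
            primitive Φ (Q * ((1 - a) * (1 - b)))) / 2 + Φ Q * Q * ((a ^ 2 + b ^ 2) / 2) := by
          have h4 := mul_le_mul_of_nonneg_left (abs_mul_le a b)
            (by positivity : 0 ≤ Φ Q * Q)
          linarith
        have h5 : D.length J * (Φ Q * Q * ((a ^ 2 + b ^ 2) / 2)) ≤
            A / 8 * (D.length J * Φ Q * (4 * (a ^ 2 + b ^ 2))) := by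
          calc _ = Q / 8 * (D.length J * Φ Q * (4 * (a ^ 2 + b ^ 2))) := by ring
            _ ≤ _ := by
              gcongr
              exact hle J
        have h6 := mul_le_mul_of_nonneg_left h3 hJ.le
        linarith)
  have hfinal : primitive Φ A ≤ A / 8 * C := by
    by_contra hlt
    push Not at hlt
    obtain ⟨s, hsA, hs⟩ := exists_Ioc_subset_of_mem_nhds
      ((continuous_primitive h).continuousAt.eventually (eventually_gt_nhds hlt))
      (exists_lt A)
    have hbound : ∀ J, avgProd D w J ≤ s := fun J => by
      by_contra hJ
      exact absurd (key J) (not_le.2 (hs ⟨not_le.1 hJ, hle J⟩))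
    have hs0 : 0 ≤ s := zero_le_one.trans ((hone (0, 0)).trans (hbound _))
    have := ENNReal.toReal_mono ENNReal.ofReal_ne_top (hd.a2Char_le hd' hbound)
    rw [ENNReal.toReal_ofReal hs0] at this
    linarith
  rw [uFun_eq hA1, div_mul_eq_mul_div, div_le_iff₀ hA0]
  linarith

end

end DyadicA2

namespace DyadicA2

/-! A weight outside `A₂ᵈ` with a sparse sequence of differences -/

/-- The function equal to `2 ^ (-k)` on the right half of `[2 ^ k, 2 ^ (k + 1))`, `k ∈ ℕ`, and to
`1` elsewhere. -/
noncomputable def stepFun (t : ℝ) : ℝ :=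
  if 3 * (2 : ℝ) ^ Nat.log 2 ⌊t⌋₊ ≤ 2 * t then (1 / 2) ^ Nat.log 2 ⌊t⌋₊ else 1

lemma log_floor_eq {t : ℝ} {k : ℕ} (h1 : 2 ^ k ≤ t) (h2 : t < 2 ^ (k + 1)) :
    Nat.log 2 ⌊t⌋₊ = k := by
  have h0 : (0 : ℝ) ≤ t := le_trans (by positivity) h1
  refine Nat.log_eq_of_pow_le_of_lt_pow ?_ ?_
  · exact Nat.le_floor (by exact_mod_cast h1)
  · exact (Nat.floor_lt h0).2 (by exact_mod_cast h2)

lemma stepFun_of_lt_two {t : ℝ} (ht : t < 2) : stepFun t = 1 := by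
  have h : Nat.log 2 ⌊t⌋₊ = 0 := Nat.log_of_lt ((Nat.floor_lt' two_ne_zero).2 (by exact_mod_cast ht))
  simp [stepFun, h]

lemma stepFun_left {t : ℝ} {k : ℕ} (h1 : 2 ^ k ≤ t) (h2 : 2 * t < 3 * 2 ^ k) :
    stepFun t = 1 := by
  have h : Nat.log 2 ⌊t⌋₊ = k := log_floor_eq h1 (by
    have : (0 : ℝ) < 2 ^ k := by positivity
    rw [pow_succ]; linarith)
  rw [stepFun, h, if_neg (not_le.2 h2)]

lemma stepFun_right {t : ℝ} {k : ℕ} (h1 : 3 * 2 ^ k ≤ 2 * t) (h2 : t < 2 ^ (k + 1)) :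
    stepFun t = (1 / 2) ^ k := by
  have h : Nat.log 2 ⌊t⌋₊ = k := log_floor_eq (by
    have : (0 : ℝ) < 2 ^ k := by positivity
    linarith) h2
  rw [stepFun, h, if_pos h1]

lemma stepFun_pos (t : ℝ) : 0 < stepFun t := by
  unfold stepFun; split_ifs <;> positivity

lemma stepFun_le_one (t : ℝ) : stepFun t ≤ 1 := by
  unfold stepFun
  split_ifs
  · exact pow_le_one₀ (by norm_num) (by norm_num)
  · exact le_rfl

lemma inv_stepFun_le (t : ℝ) : (stepFun t)⁻¹ ≤ max 1 t := by
  unfold stepFun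
  split_ifs with h
  · have : (0 : ℝ) < 2 ^ Nat.log 2 ⌊t⌋₊ := by positivity
    rw [one_div, inv_pow, inv_inv]
    exact le_max_of_le_right (by linarith)
  · simp

lemma measurable_stepFun : Measurable stepFun := by
  have hlog : Measurable fun t : ℝ => Nat.log 2 ⌊t⌋₊ :=
    (measurable_from_top (f := Nat.log 2)).comp Nat.measurable_floor
  have h2 : Measurable fun t : ℝ => (2 : ℝ) ^ Nat.log 2 ⌊t⌋₊ :=
    (measurable_from_top (f := fun k : ℕ => (2 : ℝ) ^ k)).comp hlog
  have h3 : Measurable fun t : ℝ => (1 / 2 : ℝ) ^ Nat.log 2 ⌊t⌋₊ :=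
    (measurable_from_top (f := fun k : ℕ => (1 / 2 : ℝ) ^ k)).comp hlog
  exact Measurable.ite (measurableSet_le (h2.const_mul 3) (measurable_id.const_mul 2)) h3
    measurable_const

/-- `stepFun` in the coordinate of the lattice `D`. -/
noncomputable def stepWeight (D : Lattice) (x : ℝ) : ℝ := stepFun ((x - D.origin) / D.size)

section

variable (D : Lattice)

lemma measurable_stepWeight : Measurable (stepWeight D) :=
  measurable_stepFun.comp ((measurable_id.sub_const _).div_const _)

lemma isWeight_stepWeight : IsWeight (stepWeight D) := by
  refine ⟨?_, Eventually.of_forall fun x => stepFun_pos _⟩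
  refine (continuous_const (y := (1 : ℝ))).locallyIntegrable.mono
    (measurable_stepWeight D).aestronglyMeasurable (Eventually.of_forall fun x => ?_)
  rw [stepWeight, Real.norm_of_nonneg (stepFun_pos _).le, norm_one]
  exact stepFun_le_one _

lemma isWeight_inv_stepWeight : IsWeight (stepWeight D)⁻¹ := by
  refine ⟨?_, Eventually.of_forall fun x => inv_pos.2 (stepFun_pos _)⟩
  have hc : Continuous fun x : ℝ => max 1 ((x - D.origin) / D.size) := by fun_prop
  refine hc.locallyIntegrable.mono
    (measurable_stepWeight D).inv.aestronglyMeasurable (Eventually.of_forall fun x => ?_)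
  rw [Pi.inv_apply, stepWeight, Real.norm_of_nonneg (inv_pos.2 (stepFun_pos _)).le,
    Real.norm_of_nonneg (zero_le_one.trans (le_max_left _ _))]
  exact inv_stepFun_le _

variable {D}

lemma mem_interval_iff {J : Index} {x : ℝ} : x ∈ D.interval J ↔
    J.2 * (2 : ℝ) ^ J.1 ≤ (x - D.origin) / D.size ∧
      (x - D.origin) / D.size < (J.2 + 1) * (2 : ℝ) ^ J.1 := by
  rw [Lattice.interval, mem_Ico, Lattice.length, le_div_iff₀ D.size_pos, div_lt_iff₀ D.size_pos]
  constructor <;> rintro ⟨h1, h2⟩ <;> constructor <;> linarith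

lemma avg_eq_of_eqOn {w : ℝ → ℝ} {J : Index} {r : ℝ} (h : ∀ x ∈ D.interval J, w x = r) :
    avg D w J = r := by
  have hJ := D.length_pos J
  have h1 := length_mul_avg D w J
  rw [setIntegral_congr_fun (D.measurableSet_interval J) h, setIntegral_const,
    D.volume_real_interval, smul_eq_mul] at h1
  exact mul_left_cancel₀ hJ.ne' h1

lemma diff_eq_zero_of_eqOn {w : ℝ → ℝ} {J : Index} {r : ℝ} (h : ∀ x ∈ D.interval J, w x = r) :
    diff D w J = 0 := by
  rw [D.interval_eq_union J] at h
  rw [diff, avg_eq_of_eqOn fun x hx => h x (Or.inl hx),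
    avg_eq_of_eqOn fun x hx => h x (Or.inr hx), sub_self]

lemma stepWeight_eqOn_interval {J : Index} (h0 : J.2 ≠ 0) (h1 : J.2 ≠ 1) :
    ∃ r, ∀ x ∈ D.interval J, stepWeight D x = r := by
  obtain ⟨j, m⟩ := J
  simp only at h0 h1
  have hj : (0 : ℝ) < 2 ^ j := zpow_pos two_pos _
  rcases lt_or_ge m 0 with hm | hm
  · refine ⟨1, fun x hx => stepFun_of_lt_two ?_⟩
    have h2 := (mem_interval_iff.1 hx).2
    have h3 : ((m : ℝ) + 1) * 2 ^ j ≤ 0 :=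
      mul_nonpos_of_nonpos_of_nonneg (by exact_mod_cast hm) hj.le
    simp only at h2
    linarith
  obtain ⟨n, rfl⟩ := Int.eq_ofNat_of_zero_le hm
  have hn : 2 ≤ n := by omega
  obtain ⟨s, hs⟩ := Nat.exists_eq_succ_of_ne_zero (Nat.log_pos one_lt_two hn).ne'
  have hlow : 2 ^ (s + 1) ≤ n := by
    have := Nat.pow_log_le_self 2 (show n ≠ 0 by omega)
    rwa [hs] at this
  have hupp : n + 1 ≤ 2 ^ (s + 2) := by
    have := Nat.lt_pow_succ_log_self one_lt_two n
    rwa [hs] at this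
  rcases le_or_gt (j + s + 1) 0 with hk | hk
  · refine ⟨1, fun x hx => stepFun_of_lt_two ?_⟩
    have h2 := (mem_interval_iff.1 hx).2
    simp only [Int.cast_natCast] at h2
    refine h2.trans_le ?_
    have h3 : (n : ℝ) + 1 ≤ 2 ^ (s + 2) := by exact_mod_cast hupp
    calc ((n : ℝ) + 1) * 2 ^ j ≤ 2 ^ (s + 2) * 2 ^ j := by gcongr
      _ = 2 ^ (j + s + 2) := by
        rw [← zpow_natCast, ← zpow_add₀ two_ne_zero]; congr 1; push_cast; ring
      _ ≤ 2 ^ (1 : ℤ) := zpow_le_zpow_right₀ one_le_two (by omega)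
      _ = 2 := zpow_one 2
  obtain ⟨k, hk'⟩ := Int.eq_ofNat_of_zero_le hk.le
  have hpow : (2 : ℝ) ^ k = 2 ^ (s + 1) * 2 ^ j := by
    rw [← zpow_natCast, ← zpow_natCast, ← zpow_add₀ two_ne_zero]; congr 1; push_cast; omega
  rcases lt_or_ge n (3 * 2 ^ s) with h3 | h3
  · refine ⟨1, fun x hx => stepFun_left (k := k) ?_ ?_⟩
    · refine le_trans ?_ (mem_interval_iff.1 hx).1
      rw [hpow]
      simp only [Int.cast_natCast]
      gcongr
      exact_mod_cast hlow
    · have h2 := (mem_interval_iff.1 hx).2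
      simp only [Int.cast_natCast] at h2
      have h4 : (n : ℝ) + 1 ≤ 3 * 2 ^ s := by exact_mod_cast h3
      have h5 := mul_le_mul_of_nonneg_right h4 hj.le
      rw [hpow, pow_succ]
      linarith
  · refine ⟨(1 / 2) ^ k, fun x hx => stepFun_right ?_ ?_⟩
    · have h2 := (mem_interval_iff.1 hx).1
      simp only [Int.cast_natCast] at h2
      have h4 : 3 * (2 : ℝ) ^ s ≤ n := by exact_mod_cast h3
      have h5 := mul_le_mul_of_nonneg_right h4 hj.le
      rw [hpow, pow_succ]
      linarith
    · refine (mem_interval_iff.1 hx).2.trans_le ?_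
      have h4 : (n : ℝ) + 1 ≤ 2 ^ (s + 2) := by exact_mod_cast hupp
      have h5 := mul_le_mul_of_nonneg_right h4 hj.le
      simp only [Int.cast_natCast]
      rw [pow_succ (2 : ℝ) k, hpow]
      rw [pow_succ (2 : ℝ) (s + 1)] at h5
      linarith

lemma cSeq_stepWeight_eq_zero (Φ : ℝ → ℝ) {J : Index} (h0 : J.2 ≠ 0) (h1 : J.2 ≠ 1) :
    cSeq D Φ (stepWeight D) J = 0 := by
  obtain ⟨r, hr⟩ := stepWeight_eqOn_interval (D := D) h0 h1
  rw [cSeq, diff_eq_zero_of_eqOn hr,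
    diff_eq_zero_of_eqOn (w := (stepWeight D)⁻¹) (r := r⁻¹) fun x hx => by
      rw [Pi.inv_apply, hr x hx]]
  simp

variable (D)

lemma a2Char_stepWeight : a2Char D (stepWeight D) = ∞ := by
  have hd := (isWeight_stepWeight D).dyadicWeight D
  have hd' := (isWeight_inv_stepWeight D).dyadicWeight D
  have hk : ∀ k : ℕ, ENNReal.ofReal (2 ^ k / 4) ≤ a2Char D (stepWeight D) := fun k => by
    refine le_trans (ENNReal.ofReal_le_ofReal ?_) (hd.ofReal_avgProd_le hd' (k, 1))
    have hp : (2 : ℝ) ^ ((k : ℤ) - 1) = 2 ^ k / 2 := by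
      rw [zpow_sub_one₀ two_ne_zero, zpow_natCast, div_eq_mul_inv]
    have hl : ∀ x ∈ D.interval (leftHalf (k, 1)), stepWeight D x = 1 := fun x hx => by
      obtain ⟨h1, h2⟩ := mem_interval_iff.1 hx
      simp only [leftHalf, hp] at h1 h2
      push_cast at h1 h2
      exact stepFun_left (k := k) (by linarith) (by linarith)
    have hr : ∀ x ∈ D.interval (rightHalf (k, 1)), stepWeight D x = (1 / 2) ^ k := fun x hx => by
      obtain ⟨h1, h2⟩ := mem_interval_iff.1 hx
      simp only [rightHalf, hp] at h1 h2
      push_cast at h1 h2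
      exact stepFun_right (by linarith) (by rw [pow_succ]; linarith)
    rw [avgProd, hd.avg_eq, hd'.avg_eq, avg_eq_of_eqOn hl, avg_eq_of_eqOn hr,
      avg_eq_of_eqOn (w := (stepWeight D)⁻¹) (r := 1) fun x hx => by
        rw [Pi.inv_apply, hl x hx, inv_one],
      avg_eq_of_eqOn (w := (stepWeight D)⁻¹) (r := 2 ^ k) fun x hx => by
        rw [Pi.inv_apply, hr x hx, one_div, inv_pow, inv_inv]]
    have h1 : (0 : ℝ) ≤ (1 / 2) ^ k := by positivity
    have h2 : (0 : ℝ) < 2 ^ k := by positivity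
    nlinarith [mul_nonneg h1 h2.le]
  by_contra hne
  obtain ⟨k, hk'⟩ := pow_unbounded_of_one_lt (4 * (a2Char D (stepWeight D)).toReal)
    (one_lt_two : (1 : ℝ) < 2)
  have := (ENNReal.ofReal_le_iff_le_toReal hne).1 (hk k)
  linarith

lemma isCarleson_stepWeight {Φ : ℝ → ℝ} (h0 : ∀ t ∈ Ici (1 : ℝ), 0 ≤ Φ t) {K : ℝ}
    (hK : ∀ t ∈ Ici (1 : ℝ), Φ t ≤ K) : IsCarleson D (cSeq D Φ (stepWeight D)) := by
  have hd := (isWeight_stepWeight D).dyadicWeight D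
  have hd' := (isWeight_inv_stepWeight D).dyadicWeight D
  have hK0 : 0 ≤ K := (h0 1 (mem_Ici.2 le_rfl)).trans (hK 1 (mem_Ici.2 le_rfl))
  have hnn := hd.cSeq_nonneg hd' h0
  refine ⟨hnn, lt_of_le_of_lt ((carlesonNorm_le_iff D hnn (B := 32 * K) (by positivity)).2
    fun I n => ?_) ENNReal.ofReal_lt_top⟩
  have hI := D.length_pos I
  have hle : ∀ J, cSeq D Φ (stepWeight D) J ≤ 8 * K * D.length J := fun J => by
    have hJ := D.length_pos J
    have hΦ := hK _ (hd.one_le_avgProd hd' J)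
    have ha := (sq_lt_one_iff_abs_lt_one _).2 (hd.abs_relDiff_lt J)
    have hb := (sq_lt_one_iff_abs_lt_one _).2 (hd'.abs_relDiff_lt J)
    rw [hd.cSeq_eq hd']
    calc _ ≤ D.length J * K * (4 * (1 + 1)) := by gcongr
      _ = _ := by ring
  have hgen : ∀ i, genSum (cSeq D Φ (stepWeight D)) I i ≤ 16 * K * D.length I * (1 / 2) ^ i := by
    intro i
    let S := (Finset.range (2 ^ i)).filter fun k : ℕ =>
      (2 ^ i * I.2 + k : ℤ) ∈ ({0, 1} : Finset ℤ)
    have hcard : S.card ≤ 2 := by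
      refine (Finset.card_le_card_of_injOn (t := ({0, 1} : Finset ℤ))
        (fun k : ℕ => (2 ^ i * I.2 + k : ℤ)) (fun k hk => (Finset.mem_filter.1 hk).2)
        fun a _ b _ hab => ?_).trans Finset.card_le_two
      simp only at hab
      omega
    have hS : genSum (cSeq D Φ (stepWeight D)) I i =
        ∑ k ∈ S, cSeq D Φ (stepWeight D) (descendant I i k) := by
      refine (Finset.sum_subset (Finset.filter_subset _ _) fun k hk hkS => ?_).symm
      have hne : (2 ^ i * I.2 + k : ℤ) ∉ ({0, 1} : Finset ℤ) := fun h =>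
        hkS (Finset.mem_filter.2 ⟨hk, h⟩)
      simp only [Finset.mem_insert, Finset.mem_singleton, not_or] at hne
      exact cSeq_stepWeight_eq_zero Φ hne.1 hne.2
    rw [hS]
    calc _ ≤ S.card • (8 * K * (D.length I / 2 ^ i)) := by
          refine Finset.sum_le_card_nsmul _ _ _ fun k _ => ?_
          rw [← D.length_descendant I i k]
          exact hle _
      _ ≤ 2 * (8 * K * (D.length I / 2 ^ i)) := by
          rw [nsmul_eq_mul]
          gcongr
          exact_mod_cast hcard
      _ = _ := by rw [one_div, inv_pow]; ring
  calc _ ≤ ∑ i ∈ Finset.range n, 16 * K * D.length I * (1 / 2) ^ i :=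
        Finset.sum_le_sum fun i _ => hgen i
    _ = 16 * K * D.length I * ∑ i ∈ Finset.range n, (1 / 2 : ℝ) ^ i := by rw [Finset.mul_sum]
    _ ≤ 16 * K * D.length I * 2 := by
        gcongr
        exact sum_geometric_two_le n
    _ = _ := by ring

end

lemma exists_bound_of_not_tendsto {Φ : ℝ → ℝ} (h : MonotoneOn Φ (Ici 1))
    (hnt : ¬ Tendsto Φ atTop atTop) : ∃ K, ∀ t ∈ Ici (1 : ℝ), Φ t ≤ K := by
  by_contra! hK
  refine hnt (tendsto_atTop.2 fun b => ?_)
  obtain ⟨s, hs, hb⟩ := hK b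
  filter_upwards [eventually_ge_atTop s] with t ht
  exact hb.le.trans (h hs (hs.trans ht) ht)

end DyadicA2

theorem theorem2p6 (D : DyadicA2.Lattice) (Φ : ℝ → ℝ)
    (hΦ_nonneg : ∀ t ∈ Set.Ici (1 : ℝ), 0 ≤ Φ t) (hΦ_mono : MonotoneOn Φ (Set.Ici 1)) :
    -- upper bound for `A₂ᵈ` weights
    (∀ w : ℝ → ℝ, DyadicA2.MemA2 D w →
      DyadicA2.IsCarleson D (DyadicA2.cSeq D Φ w) ∧
      (DyadicA2.carlesonNorm D (DyadicA2.cSeq D Φ w)).toReal ≤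
        8 * Φ (DyadicA2.a2Char D w).toReal * Real.log (DyadicA2.a2Char D w).toReal) ∧
    -- unbounded `Φ`: lower bound
    (Filter.Tendsto Φ Filter.atTop Filter.atTop →
      -- `v : [0, ∞) → [1, ∞)` is a right inverse of `u`, and the two-sided inverse if `Φ > 0`
      -- on `(1, ∞)`
      (Set.MapsTo (DyadicA2.vFun Φ) (Set.Ici 0) (Set.Ici 1) ∧
        Set.RightInvOn (DyadicA2.vFun Φ) (DyadicA2.uFun Φ) (Set.Ici 0) ∧
        ((∀ t ∈ Set.Ioi (1 : ℝ), 0 < Φ t) →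
          Set.BijOn (DyadicA2.uFun Φ) (Set.Ici 1) (Set.Ici 0) ∧
          Set.InvOn (DyadicA2.vFun Φ) (DyadicA2.uFun Φ) (Set.Ici 1) (Set.Ici 0))) ∧
      ∀ w : ℝ → ℝ, DyadicA2.IsWeight w → DyadicA2.IsWeight w⁻¹ →
        DyadicA2.IsCarleson D (DyadicA2.cSeq D Φ w) →
        DyadicA2.MemA2 D w ∧
        (DyadicA2.a2Char D w).toReal ≤
          DyadicA2.vFun Φ (DyadicA2.carlesonNorm D (DyadicA2.cSeq D Φ w)).toReal) ∧
    -- bounded `Φ`: counterexample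
    (¬ Filter.Tendsto Φ Filter.atTop Filter.atTop →
      ∃ w : ℝ → ℝ, DyadicA2.IsWeight w ∧ DyadicA2.IsWeight w⁻¹ ∧ ¬ DyadicA2.MemA2 D w ∧
        DyadicA2.IsCarleson D (DyadicA2.cSeq D Φ w)) := by
  refine ⟨fun w hw => ?_, fun htop => ⟨?_, fun w hw hw' hc => ?_⟩, fun hnt => ?_⟩
  · have hd := hw.1.dyadicWeight D
    have hd' := hw.dyadicWeight_inv
    have hle := DyadicA2.carlesonNorm_le_of_memA2 hΦ_nonneg hΦ_mono hw
    refine ⟨⟨hd.cSeq_nonneg hd' hΦ_nonneg, hle.trans_lt ENNReal.ofReal_lt_top⟩, ?_⟩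
    have hA : 1 ≤ (DyadicA2.a2Char D w).toReal :=
      (hd.one_le_avgProd hd' (0, 0)).trans (hd.avgProd_le hd' hw.2 _)
    have hΦA := hΦ_nonneg _ hA
    have hlog := Real.log_nonneg hA
    exact ENNReal.toReal_le_of_le_ofReal (by positivity) hle
  · have hu := DyadicA2.tendsto_uFun hΦ_nonneg hΦ_mono htop
    exact ⟨fun y hy => DyadicA2.one_le_vFun hu hy, fun y hy => DyadicA2.uFun_vFun hΦ_mono hu hy,
      fun hpos => DyadicA2.uFun_bijOn_invOn hΦ_nonneg hΦ_mono hu hpos⟩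
  · have hu := DyadicA2.tendsto_uFun hΦ_nonneg hΦ_mono htop
    obtain ⟨B, hB⟩ := DyadicA2.exists_avgProd_le htop hw hw' hc
    have hA : DyadicA2.a2Char D w < ∞ :=
      ((hw.dyadicWeight D).a2Char_le (hw'.dyadicWeight D) hB).trans_lt ENNReal.ofReal_lt_top
    exact ⟨⟨hw, hA⟩, le_csSup (DyadicA2.bddAbove_sublevel_uFun hu _)
      (DyadicA2.uFun_a2Char_le hΦ_nonneg hΦ_mono hw hw' hA hc)⟩
  · obtain ⟨K, hK⟩ := DyadicA2.exists_bound_of_not_tendsto hΦ_mono hnt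
    exact ⟨DyadicA2.stepWeight D, DyadicA2.isWeight_stepWeight D,
      DyadicA2.isWeight_inv_stepWeight D,
      fun h => h.2.ne (DyadicA2.a2Char_stepWeight D),
      DyadicA2.isCarleson_stepWeight D hΦ_nonneg hK⟩
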